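/- Let $n\in\mathbb N$, let $\mathbb T^n=\mathbb R^n/\mathbb Z^n$ with projection $x\mapsto[x]$, and identify $T^*\mathbb T^n$ with $\mathbb T^n\times\mathbb R^n$, on which $\mathbb R^n\times\mathbb R^n$ acts by translations, $(a,b)\cdot(q,p)=(q+[a],p+b)$. For $(v,w)\in\mathbb R^{2n}$ let $\pi_{(v,w)}$ be the canonical projection of $\mathbb T^n\times\mathbb R^n$ onto the space $(\mathbb T^n\times\mathbb R^n)/\{(v,w)\}^\perp$ of orbits of the subgroup $\{(v,w)\}^\perp=\{(a,b)\in\mathbb R^{2n}: v\cdot a+w\cdot b=0\}$, with the quotient topology. The commutative resolvent algebra $C_{\mathcal R}(T^*\mathbb T^n)$ is the C*-subalgebra of $C_{\mathrm b}(\mathbb T^n\times\mathbb R^n)$ generated by all functions $f\circ\pi_{(v,w)}$ with $(v,w)\in\mathbb R^{2n}$ and $f\in C_0\big((\mathbb T^n\times\mathbb R^n)/\{(v,w)\}^\perp\big)$ (continuous complex-valued functions vanishing at infinity). Theorem. Let $V\in C^1(\mathbb T^n)$ be real-valued, and suppose that $\nabla V:\mathbb T^n\to\mathbb R^n$ is Lipschitz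 continuous. Then for every $(q_0,p_0)\in\mathbb T^n\times\mathbb R^n$ there is a unique curve $(q,p):\mathbb R\to\mathbb T^n\times\mathbb R^n$ that satisfies the Hamilton equations of $H(q,p)=\tfrac12p^2+V(q)$, namely $\dot q(t)=p(t)$ and $\dot p(t)=-\nabla V(q(t))$ for all $t\in\mathbb R$, with $(q(0),p(0))=(q_0,p_0)$. For every $t\in\mathbb R$, the time evolution $\Phi^t_V:(q_0,p_0)\mapsto(q(t),p(t))$ is a homeomorphism of $\mathbb T^n\times\mathbb R^n$, and $$(\Phi^t_V)^*\big(C_{\mathcal R}(T^*\mathbb T^n)\big)=C_{\mathcal R}(T^*\mathbb T^n),$$ where $(\Phi^t_V)^*f=f\circ\Phi^t_V$. -/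

import Mathlib

open scoped BoundedContinuousFunction ZeroAtInfty Topology

noncomputable section

namespace TorusResolvent

/-- Euclidean space `ℝⁿ`. -/
abbrev Euc (n : ℕ) : Type := EuclideanSpace ℝ (Fin n)

/-- The torus `𝕋ⁿ = (ℝ / ℤ)ⁿ`. -/
abbrev Torus (n : ℕ) : Type := UnitAddTorus (Fin n)

/-- The phase space `T*𝕋ⁿ`, identified with `𝕋ⁿ × ℝⁿ`. -/
abbrev PhaseSpace (n : ℕ) : Type := Torus n × Euc n

/-- The canonical projection `ℝⁿ → 𝕋ⁿ`, `x ↦ [x] = x + ℤⁿ`. -/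
def toTorus {n : ℕ} (x : Euc n) : Torus n := fun i => ((x i : ℝ) : UnitAddCircle)

/-! ### The commutative resolvent algebra -/

/-- The orbit relation on `𝕋ⁿ × ℝⁿ` of the translation action
`(a, b) · (q, p) = (q + [a], p + b)`, restricted to the hyperplane (or whole space)
`{(v, w)}^⊥ = {(a, b) : v · a + w · b = 0} ⊆ ℝⁿ × ℝⁿ`. -/
def orbitSetoid {n : ℕ} (v w : Euc n) : Setoid (PhaseSpace n) where
  r x y := ∃ a b : Euc n, inner ℝ v a + inner ℝ w b = 0 ∧
    y.1 = x.1 + toTorus a ∧ y.2 = x.2 + b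
  iseqv := by
    refine ⟨fun x => ⟨0, 0, ?_, ?_, ?_⟩, ?_, ?_⟩
    · simp
    · funext i; simp [toTorus]
    · simp
    · rintro x y ⟨a, b, h, h1, h2⟩
      refine ⟨-a, -b, ?_, ?_, ?_⟩
      · rw [inner_neg_right, inner_neg_right]; linarith
      · rw [h1]; funext i; simp [toTorus]
      · rw [h2]; simp
    · rintro x y z ⟨a, b, h, h1, h2⟩ ⟨c, d, h', h1', h2'⟩
      refine ⟨a + c, b + d, ?_, ?_, ?_⟩
      · rw [inner_add_right, inner_add_right]; linarith
      · rw [h1', h1]; funext i; simp [toTorus, add_assoc]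
      · rw [h2', h2, add_assoc]

/-- The space of orbits `(𝕋ⁿ × ℝⁿ) / {(v, w)}^⊥`, with the quotient topology. -/
abbrev OrbitSpace {n : ℕ} (v w : Euc n) : Type := Quotient (orbitSetoid v w)

/-- The canonical projection `π_(v, w)` onto the space of orbits. -/
def orbitProj {n : ℕ} (v w : Euc n) : PhaseSpace n → OrbitSpace v w :=
  Quotient.mk (orbitSetoid v w)

/-- The functions `f ∘ π_(v, w)` with `f ∈ C₀((𝕋ⁿ × ℝⁿ) / {(v, w)}^⊥)`, for all `v`, `w`. -/
def resolventGenerators (n : ℕ) : Set (PhaseSpace n →ᵇ ℂ) :=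
  {F | ∃ (v w : Euc n) (f : C₀(OrbitSpace v w, ℂ)), ∀ x, F x = f (orbitProj v w x)}

/-- The commutative resolvent algebra `C_R(T*𝕋ⁿ)`: the C*-subalgebra of `C_b(𝕋ⁿ × ℝⁿ)`
generated by the functions `f ∘ π_(v, w)`, that is, the norm closure of the star subalgebra
that they generate. -/
def resolventAlgebra (n : ℕ) : NonUnitalStarSubalgebra ℂ (PhaseSpace n →ᵇ ℂ) :=
  (NonUnitalStarAlgebra.adjoin ℂ (resolventGenerators n)).topologicalClosure

/-! ### Calculus on the torus and the Hamiltonian flow -/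

/-- `V` is continuously differentiable on `𝕋ⁿ`: its periodic lift to `ℝⁿ` is. -/
def IsC1 {n : ℕ} (V : Torus n → ℝ) : Prop :=
  ContDiff ℝ 1 (fun x : Euc n => V (toTorus x))

/-- The gradient `∇V : 𝕋ⁿ → ℝⁿ`, computed at `q` in the chart `x ↦ q + [x]`. -/
def torusGradient {n : ℕ} (V : Torus n → ℝ) (q : Torus n) : Euc n :=
  gradient (fun x : Euc n => V (q + toTorus x)) 0

/-- The curve `q` in `𝕋ⁿ` is differentiable at the time `t`, with derivative `u ∈ ℝⁿ`:
near `t` it is the image `[x]` of a curve `x` in `ℝⁿ` with derivative `u` at `t`. -/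
def HasTorusDerivAt {n : ℕ} (q : ℝ → Torus n) (u : Euc n) (t : ℝ) : Prop :=
  ∃ x : ℝ → Euc n, (∀ᶠ s in 𝓝 t, q s = toTorus (x s)) ∧ HasDerivAt x u t

/-- `γ = (q, p)` solves the Hamilton equations of `H(q, p) = p² / 2 + V(q)` for all times:
`q' = p` and `p' = -∇V(q)`. -/
def IsHamiltonianTrajectory {n : ℕ} (V : Torus n → ℝ) (γ : ℝ → PhaseSpace n) : Prop :=
  ∀ t : ℝ, HasTorusDerivAt (fun s => (γ s).1) (γ t).2 t ∧
    HasDerivAt (fun s => (γ s).2) (-torusGradient V (γ t).1) t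

/-- `Φ` is the Hamiltonian flow of `H(q, p) = p² / 2 + V(q)`: for every initial point `x`,
`t ↦ Φ t x` is a solution of the Hamilton equations that starts at `x`. -/
def IsHamiltonianFlow {n : ℕ} (V : Torus n → ℝ) (Φ : ℝ → PhaseSpace n → PhaseSpace n) : Prop :=
  ∀ x : PhaseSpace n, IsHamiltonianTrajectory V (fun t => Φ t x) ∧ Φ 0 x = x

end TorusResolvent

end

open TorusResolvent

noncomputable section

namespace TorusResolvent

variable {n : ℕ}

/-! ### The projection onto the torus -/

/-! The flow is a limit of iterated explicit steps, each of which preserves the algebra. One step of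
length `τ` sends `(q, p)` to `(q + [τ p], p + ∫₀^τ F(q + [s p]) ds)` with `F = -∇V`. Letting the
force act along the free trajectory keeps the error of `N` steps of length `t / N` below `C / N`
uniformly in the unbounded momentum (`exists_norm_newton_sub_iterate_newtonStep_le`); freezing the
force at `q` would cost a local error of order `|p| τ²`. Generators are uniformly continuous under
translations (`resolventGenerators_uniformContinuous`), so the pull-backs converge in norm and the
closed algebra contains the limit.

That a step preserves the algebra need only be checked on a generator `G` with parameters `(v, w)`
(`compContinuous_torusStep_mem`). `G` sees the momentum increment only through its product with `w`,
a real function `S`. Hence `G ∘ step` at `x` is `T (S x) x`, where `T r` is `G` composed with an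
affine shear, again a generator (`compContinuous_shear_mem`). `S` is a free time average of a
function on the torus: for a character it is the character times a decaying function of `k · p` (or
a constant if `k = 0`), and Fourier density gives the rest (`freeAverage_mem`). Bernstein
polynomials allow `S` to be substituted for `r` (`mem_resolventAlgebra_of_real`).

The reverse inclusion is the same statement at time `-t`. -/

@[simp] lemma toTorus_apply (x : Euc n) (i : Fin n) : toTorus x i = ((x i : ℝ) : UnitAddCircle) := rfl

@[simp] lemma toTorus_zero : toTorus (0 : Euc n) = 0 := by funext i; simp

lemma toTorus_add (x y : Euc n) : toTorus (x + y) = toTorus x + toTorus y := by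
  funext i; simp

lemma toTorus_neg (x : Euc n) : toTorus (-x) = -toTorus x := by
  funext i; simp

lemma toTorus_sub (x y : Euc n) : toTorus (x - y) = toTorus x - toTorus y := by
  funext i; simp

lemma toTorus_surjective : Function.Surjective (toTorus (n := n)) := by
  intro q
  choose x hx using fun i => QuotientAddGroup.mk_surjective (q i)
  exact ⟨WithLp.toLp 2 x, funext hx⟩

lemma norm_toTorus_le (x : Euc n) : ‖toTorus x‖ ≤ ‖x‖ := by
  refine (pi_norm_le_iff_of_nonneg (norm_nonneg x)).2 fun i => ?_
  refine le_trans ?_ (PiLp.norm_apply_le x i)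
  exact QuotientAddGroup.norm_mk_le_norm

lemma lipschitzWith_toTorus : LipschitzWith 1 (toTorus (n := n)) := by
  refine LipschitzWith.of_dist_le_mul fun x y => ?_
  rw [dist_eq_norm, dist_eq_norm, ← toTorus_sub, NNReal.coe_one, one_mul]
  exact norm_toTorus_le _

lemma continuous_toTorus : Continuous (toTorus (n := n)) := lipschitzWith_toTorus.continuous

/-! ### Newton's equation with a bounded Lipschitz force -/

section Newton

variable {E : Type*} [NormedAddCommGroup E]

lemma lipschitzWith_newton {F : E → E} {K : NNReal} (hF : LipschitzWith K F) :
    LipschitzWith (max 1 K) (fun z : E × E => (z.2, F z.1)) := by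
  have h1 : LipschitzWith (1 : NNReal) (fun z : E × E => z.2) := LipschitzWith.prod_snd
  have h2 : LipschitzWith (K * 1) (fun z : E × E => F z.1) := hF.comp LipschitzWith.prod_fst
  rw [mul_one] at h2
  exact h1.prodMk h2

variable [NormedSpace ℝ E]

lemma newton_unique {F : E → E} {K : NNReal} (hF : LipschitzWith K F) {z w : ℝ → E × E}
    (hz : ∀ t, HasDerivAt z ((z t).2, F (z t).1) t)
    (hw : ∀ t, HasDerivAt w ((w t).2, F (w t).1) t) (h0 : z 0 = w 0) : z = w :=
  ODE_solution_unique_univ (v := fun _ z => (z.2, F z.1)) (s := fun _ => Set.univ)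
    (fun _ => (lipschitzWith_newton hF).lipschitzOnWith) (fun t => ⟨hz t, trivial⟩)
    (fun t => ⟨hw t, trivial⟩) h0

/-- The unknown is the deviation `y` from free motion, with position part scaled by `T`. On the ball
of radius `T * M` its vector field is bounded by `M`, so Picard-Lindelöf covers all of `[-T, T]` at
once. -/
lemma exists_newton_solution_Ioo [CompleteSpace E] {F : E → E} {K M : NNReal}
    (hF : LipschitzWith K F) (hM : ∀ x, ‖F x‖ ≤ M) (z₀ : E × E) {T : ℝ} (hT : 0 < T) :
    ∃ z : ℝ → E × E, z 0 = z₀ ∧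
      ∀ t ∈ Set.Ioo (-T) T, HasDerivAt z ((z t).2, F (z t).1) t := by
  lift T to NNReal using hT.le
  rw [NNReal.coe_pos] at hT
  have hv : IsPicardLindelof
      (fun (t : ℝ) (y : E × E) => ((T : ℝ)⁻¹ • y.2, F (z₀.1 + t • z₀.2 + (T : ℝ) • y.1)))
      (tmin := -T) (tmax := T) ⟨0, by simp⟩ (0 : E × E) (T * M) 0 M (max T⁻¹ (K * T)) := by
    refine ⟨fun t _ => LipschitzWith.lipschitzOnWith ?_, fun y _ => ?_, fun t _ y hy => ?_, ?_⟩
    · refine LipschitzWith.prodMk ?_ ?_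
      · refine LipschitzWith.of_dist_le_mul fun x y => ?_
        rw [dist_smul₀]
        simp only [norm_inv, Real.norm_eq_abs, NNReal.abs_eq, NNReal.coe_inv]
        gcongr
        exact le_max_right _ _
      · refine hF.comp (LipschitzWith.of_dist_le_mul fun x y => ?_)
        rw [dist_add_left, dist_smul₀]
        simp only [Real.norm_eq_abs, NNReal.abs_eq]
        gcongr
        exact le_max_left _ _
    · have := hF.continuous
      fun_prop
    · refine norm_prod_le_iff.2 ⟨?_, hM _⟩
      have hy2 : ‖y.2‖ ≤ T * M := by
        have := (norm_snd_le y).trans (mem_closedBall_zero_iff.1 hy)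
        exact_mod_cast this
      rw [norm_smul, norm_inv, Real.norm_eq_abs, NNReal.abs_eq, inv_mul_le_iff₀ (by exact_mod_cast hT)]
      exact hy2
    · simp [mul_comm]
  obtain ⟨α, hα0, hα⟩ := hv.exists_eq_forall_mem_Icc_hasDerivWithinAt₀
  refine ⟨fun t => (z₀.1 + t • z₀.2 + (T : ℝ) • (α t).1, z₀.2 + (α t).2), ?_, fun t ht => ?_⟩
  · have : α 0 = 0 := hα0
    simp [this]
  · have h := (hα t (Set.Ioo_subset_Icc_self ht)).hasDerivAt (Icc_mem_nhds ht.1 ht.2)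
    have h1 : HasDerivAt (fun s => (α s).1) ((T : ℝ)⁻¹ • (α t).2) t := h.fst
    have h2 : HasDerivAt (fun s => (α s).2) (F (z₀.1 + t • z₀.2 + (T : ℝ) • (α t).1)) t := h.snd
    refine HasDerivAt.prodMk ?_ ?_
    · have := (((hasDerivAt_id t).smul_const z₀.2).const_add z₀.1).add (h1.const_smul (T : ℝ))
      rw [one_smul, smul_inv_smul₀ (NNReal.coe_ne_zero.2 hT.ne')] at this
      exact this
    · exact h2.const_add z₀.2

theorem exists_newton_solution [CompleteSpace E] {F : E → E} {K M : NNReal}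
    (hF : LipschitzWith K F) (hM : ∀ x, ‖F x‖ ≤ M) (z₀ : E × E) :
    ∃ z : ℝ → E × E, z 0 = z₀ ∧ ∀ t, HasDerivAt z ((z t).2, F (z t).1) t := by
  choose z hz0 hz using fun k : ℕ =>
    exists_newton_solution_Ioo hF hM z₀ (T := (k : ℝ) + 1) (by positivity)
  have hagree : ∀ k l : ℕ, k ≤ l → Set.EqOn (z k) (z l) (Set.Ioo (-((k : ℝ) + 1)) (k + 1)) := by
    intro k l hkl
    have hkl' : (k : ℝ) ≤ l := by exact_mod_cast hkl
    refine ODE_solution_unique_of_mem_Ioo (v := fun _ z => (z.2, F z.1)) (s := fun _ => Set.univ)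
      (t₀ := 0) (fun _ _ => (lipschitzWith_newton hF).lipschitzOnWith)
      ⟨by linarith [k.cast_nonneg (α := ℝ)], by linarith [k.cast_nonneg (α := ℝ)]⟩
      (fun t ht => ⟨hz k t ht, trivial⟩)
      (fun t ht => ⟨hz l t ⟨by linarith [ht.1], by linarith [ht.2]⟩, trivial⟩) ?_
    rw [hz0, hz0]
  have hmem : ∀ t : ℝ, t ∈ Set.Ioo (-((⌈|t|⌉₊ : ℝ) + 1)) (⌈|t|⌉₊ + 1) := fun t => by
    have h1 := Nat.le_ceil |t|
    have h2 := abs_le.1 h1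
    exact ⟨by linarith, by linarith⟩
  -- The solution of index `k` lives on `(-(k + 1), k + 1)`; the extra `1` puts `t` in the interior,
  -- and nearby times have index at most `k + 1`.
  refine ⟨fun t => z ⌈|t|⌉₊ t, hz0 _, fun t => ?_⟩
  set k := ⌈|t|⌉₊ with hk
  have h := hz k t (hmem t)
  refine h.congr_of_eventuallyEq ?_
  filter_upwards [Ioo_mem_nhds (hmem t).1 (hmem t).2] with s hs
  have hs' : ⌈|s|⌉₊ ≤ k + 1 := by
    refine Nat.ceil_le.2 ?_
    have := abs_lt.2 ⟨hs.1, hs.2⟩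
    push_cast
    linarith
  rw [hagree _ _ hs' (hmem s), hagree k (k + 1) (Nat.le_succ k) hs]

end Newton

/-! ### Lifting curves on the torus -/

/-- By the reverse triangle inequality the real function `dist (g ·) (g s)` has zero derivative.
This compares curves on the torus without covering theory. -/
lemma eq_of_forall_isLittleO_dist {M : Type*} [MetricSpace M] {g : ℝ → M}
    (h : ∀ t, (fun s => dist (g s) (g t)) =o[𝓝 t] fun s => s - t) (t s : ℝ) : g t = g s := by
  have hd : ∀ t, HasDerivAt (fun r => dist (g r) (g s)) 0 t := fun t => by
    rw [hasDerivAt_iff_isLittleO]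
    refine Asymptotics.IsBigO.trans_isLittleO (Asymptotics.IsBigO.of_bound 1 ?_) (h t)
    refine Filter.Eventually.of_forall fun r => ?_
    simp only [smul_zero, sub_zero, one_mul, Real.norm_eq_abs]
    rw [abs_of_nonneg (dist_nonneg (x := g r) (y := g t))]
    exact abs_dist_sub_le _ _ _
  have := is_const_of_deriv_eq_zero (fun t => (hd t).differentiableAt) (fun t => (hd t).deriv) t s
  rw [dist_self] at this
  exact dist_eq_zero.1 this

lemma HasTorusDerivAt.isLittleO_sub {q : ℝ → Torus n} {u : Euc n} {t : ℝ}
    (hq : HasTorusDerivAt q u t) {x : ℝ → Euc n} (hx : HasDerivAt x u t) :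
    (fun s => dist (q s - toTorus (x s)) (q t - toTorus (x t))) =o[𝓝 t] fun s => s - t := by
  obtain ⟨y, hqy, hy⟩ := hq
  have h := hasDerivAt_iff_isLittleO.1 (hy.sub hx)
  refine Asymptotics.IsBigO.trans_isLittleO (Asymptotics.IsBigO.of_bound 1 ?_) h
  filter_upwards [hqy] with s hs
  rw [hs, hqy.self_of_nhds, ← toTorus_sub, ← toTorus_sub, dist_eq_norm, ← toTorus_sub, norm_norm,
    sub_self, smul_zero, sub_zero, one_mul]
  exact norm_toTorus_le _

lemma hasTorusDerivAt_toTorus {x : ℝ → Euc n} {u : Euc n} {t : ℝ} (hx : HasDerivAt x u t) :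
    HasTorusDerivAt (fun s => toTorus (x s)) u t :=
  ⟨x, Filter.Eventually.of_forall fun _ => rfl, hx⟩

/-- A curve on the torus with the derivative and the initial point of `[x]` is equal to `[x]`. -/
lemma eq_toTorus_of_hasTorusDerivAt {q : ℝ → Torus n} {x u : ℝ → Euc n}
    (hq : ∀ t, HasTorusDerivAt q (u t) t) (hx : ∀ t, HasDerivAt x (u t) t)
    (h0 : q 0 = toTorus (x 0)) (t : ℝ) : q t = toTorus (x t) := by
  have := eq_of_forall_isLittleO_dist (g := fun s => q s - toTorus (x s))
    (fun t => (hq t).isLittleO_sub (hx t)) t 0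
  simpa [h0, sub_eq_zero] using this

/-! ### Hamiltonian trajectories -/

/-- The lift of the position is the integral of the momentum: it projects to a curve with the same
velocity and starting point as `q`, hence to `q`. Uniqueness is thereby reduced to an ODE in a
vector space. -/
lemma IsHamiltonianTrajectory.exists_lift {V : Torus n → ℝ} {γ : ℝ → PhaseSpace n}
    (hγ : IsHamiltonianTrajectory V γ) {x₀ : Euc n} (h0 : (γ 0).1 = toTorus x₀) :
    ∃ z : ℝ → Euc n × Euc n, z 0 = (x₀, (γ 0).2) ∧
      (∀ t, HasDerivAt z ((z t).2, -torusGradient V (toTorus (z t).1)) t) ∧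
      ∀ t, γ t = (toTorus (z t).1, (z t).2) := by
  have hp : Continuous fun s => (γ s).2 :=
    continuous_iff_continuousAt.2 fun t => (hγ t).2.continuousAt
  set x : ℝ → Euc n := fun t => x₀ + ∫ s in (0 : ℝ)..t, (γ s).2 with hxdef
  have hx : ∀ t, HasDerivAt x (γ t).2 t := fun t =>
    (intervalIntegral.integral_hasDerivAt_right (hp.intervalIntegrable _ _)
      (hp.stronglyMeasurableAtFilter _ _) hp.continuousAt).const_add x₀
  have hx0 : x 0 = x₀ := by simp [hxdef]
  have hq := eq_toTorus_of_hasTorusDerivAt (fun t => (hγ t).1) hx (by rw [hx0, h0])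
  refine ⟨fun t => (x t, (γ t).2), by simp [hx0], fun t => ?_, fun t => ?_⟩
  · have := (hx t).prodMk (hγ t).2
    rw [hq t] at this
    exact this
  · exact Prod.ext (hq t) rfl

lemma isHamiltonianTrajectory_of_lift {V : Torus n → ℝ} {z : ℝ → Euc n × Euc n}
    (hz : ∀ t, HasDerivAt z ((z t).2, -torusGradient V (toTorus (z t).1)) t) :
    IsHamiltonianTrajectory V fun t => (toTorus (z t).1, (z t).2) := fun t =>
  ⟨hasTorusDerivAt_toTorus (hz t).fst, (hz t).snd⟩

lemma lipschitzWith_force {V : Torus n → ℝ} {K : NNReal} (hK : LipschitzWith K (torusGradient V)) :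
    LipschitzWith K fun x : Euc n => -torusGradient V (toTorus x) := by
  have := (hK.comp lipschitzWith_toTorus).neg
  rwa [mul_one] at this

lemma exists_norm_torusGradient_le {V : Torus n → ℝ} (hV : Continuous (torusGradient V)) :
    ∃ M : NNReal, ∀ q, ‖torusGradient V q‖ ≤ M := by
  obtain ⟨M, hM⟩ := isCompact_univ.exists_bound_of_continuousOn hV.continuousOn
  exact ⟨M.toNNReal, fun q => (hM q trivial).trans (Real.le_coe_toNNReal M)⟩

theorem existsUnique_isHamiltonianTrajectory {V : Torus n → ℝ} {K : NNReal}
    (hK : LipschitzWith K (torusGradient V)) (x : PhaseSpace n) :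
    ∃! γ : ℝ → PhaseSpace n, IsHamiltonianTrajectory V γ ∧ γ 0 = x := by
  obtain ⟨M, hM⟩ := exists_norm_torusGradient_le hK.continuous
  obtain ⟨x₀, hx₀⟩ := toTorus_surjective x.1
  obtain ⟨z, hz0, hz⟩ := exists_newton_solution (lipschitzWith_force hK) (M := M)
    (fun y => by rw [norm_neg]; exact hM _) (x₀, x.2)
  refine ⟨_, ⟨isHamiltonianTrajectory_of_lift hz, ?_⟩, ?_⟩
  · simp [hz0, hx₀]
  · rintro γ ⟨hγ, h0⟩
    obtain ⟨w, hw0, hw, hγw⟩ := hγ.exists_lift (x₀ := x₀) (by rw [h0, hx₀])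
    have : w = z := newton_unique (lipschitzWith_force hK) hw hz (by rw [hw0, hz0, h0])
    funext t
    rw [hγw t, this]

lemma IsHamiltonianTrajectory.comp_add_const {V : Torus n → ℝ} {γ : ℝ → PhaseSpace n}
    (hγ : IsHamiltonianTrajectory V γ) (s : ℝ) :
    IsHamiltonianTrajectory V fun t => γ (t + s) := fun t => by
  obtain ⟨⟨x, hx, hx'⟩, hp⟩ := hγ (t + s)
  refine ⟨⟨fun r => x (r + s), ?_, hx'.comp_add_const t s⟩, hp.comp_add_const t s⟩
  exact (continuous_add_const s).continuousAt.eventually hx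

lemma IsHamiltonianFlow.add {V : Torus n → ℝ} {Φ : ℝ → PhaseSpace n → PhaseSpace n}
    (hΦ : IsHamiltonianFlow V Φ) {K : NNReal} (hK : LipschitzWith K (torusGradient V))
    (t s : ℝ) (x : PhaseSpace n) : Φ (t + s) x = Φ t (Φ s x) :=
  congrFun ((existsUnique_isHamiltonianTrajectory hK (Φ s x)).unique
    ⟨(hΦ x).1.comp_add_const s, by rw [zero_add]⟩ (hΦ (Φ s x))) t

/-! ### Orbit spaces -/

lemma orbitProj_eq_iff {v w : Euc n} {x y : PhaseSpace n} :
    orbitProj v w x = orbitProj v w y ↔ ∃ a b : Euc n, inner ℝ v a + inner ℝ w b = 0 ∧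
      y.1 = x.1 + toTorus a ∧ y.2 = x.2 + b :=
  Quotient.eq (r := orbitSetoid v w)

/-- The saturation of an open set is a union of its translates. Openness makes the quotient map
stable under products. -/
lemma isOpenQuotientMap_orbitProj (v w : Euc n) : IsOpenQuotientMap (orbitProj v w) := by
  refine ⟨Quotient.mk_surjective, continuous_quotient_mk', fun U hU => ?_⟩
  refine isOpen_coinduced.2 ?_
  have : orbitProj v w ⁻¹' (orbitProj v w '' U) =
      ⋃ c ∈ {c : Euc n × Euc n | inner ℝ v c.1 + inner ℝ w c.2 = 0},
        (fun x : PhaseSpace n => (x.1 + toTorus c.1, x.2 + c.2)) ⁻¹' U := by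
    ext x
    simp only [Set.mem_preimage, Set.mem_image, Set.mem_iUnion, Set.mem_ofPred_eq, exists_prop]
    constructor
    · rintro ⟨y, hy, hxy⟩
      obtain ⟨a, b, h, h1, h2⟩ := orbitProj_eq_iff.1 hxy.symm
      exact ⟨(a, b), h, by rwa [← h1, ← h2]⟩
    · rintro ⟨c, hc, hx⟩
      exact ⟨_, hx, (orbitProj_eq_iff.2 ⟨c.1, c.2, hc, rfl, rfl⟩).symm⟩
  change IsOpen (orbitProj v w ⁻¹' (orbitProj v w '' U))
  rw [this]
  refine isOpen_biUnion fun c _ => hU.preimage ?_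
  fun_prop

/-! ### Functions in the generating set -/

/-- Decay on the orbit space, which need not be Hausdorff, is tested upstairs by compact sets
meeting the relevant orbits. -/
lemma mem_resolventGenerators_of_isCompact {v w : Euc n} {F : PhaseSpace n →ᵇ ℂ}
    (hF : ∀ x y, orbitProj v w x = orbitProj v w y → F x = F y)
    (hc : ∀ ε > 0, ∃ C : Set (PhaseSpace n), IsCompact C ∧
      ∀ x, ε ≤ ‖F x‖ → ∃ y ∈ C, orbitProj v w y = orbitProj v w x) :
    F ∈ resolventGenerators n := by
  refine ⟨v, w, ⟨⟨Quotient.lift F fun x y h => hF x y (Quotient.sound h),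
    F.continuous.quotient_lift _⟩, ?_⟩, fun x => rfl⟩
  rw [Metric.tendsto_nhds]
  intro ε hε
  obtain ⟨C, hC, hFC⟩ := hc ε hε
  refine Filter.mem_cocompact.2
    ⟨_, hC.image (isOpenQuotientMap_orbitProj v w).continuous, fun y hy => ?_⟩
  obtain ⟨x, rfl⟩ := (isOpenQuotientMap_orbitProj v w).surjective y
  by_contra h
  have h' : ¬dist (F x) 0 < ε := h
  obtain ⟨z, hz, hzx⟩ := hFC x (by simpa using h')
  exact hy ⟨z, hz, hzx⟩

lemma resolventGenerators_apply_add {F : PhaseSpace n →ᵇ ℂ} (hF : F ∈ resolventGenerators n) :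
    ∃ w : Euc n, ∀ (q : Torus n) (p b c : Euc n), inner ℝ w b = inner ℝ w c →
      F (q, p + b) = F (q, p + c) := by
  obtain ⟨v, w, f, hf⟩ := hF
  refine ⟨w, fun q p b c hbc => ?_⟩
  rw [hf, hf]
  congr 1
  refine orbitProj_eq_iff.2 ⟨0, c - b, ?_, by simp, by simp⟩
  rw [inner_zero_right, inner_sub_right, hbc, sub_self, zero_add]

/-- Functions in the generating set are uniformly continuous along translations. -/
lemma resolventGenerators_uniformContinuous {F : PhaseSpace n →ᵇ ℂ}
    (hF : F ∈ resolventGenerators n) {ε : ℝ} (hε : 0 < ε) :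
    ∃ δ > 0, ∀ a b : Euc n, ‖a‖ < δ → ‖b‖ < δ →
      ∀ x : PhaseSpace n, ‖F (x.1 + toTorus a, x.2 + b) - F x‖ < ε := by
  obtain ⟨v, w, f, hf⟩ := hF
  have hπ := isOpenQuotientMap_orbitProj v w
  -- Translations commute with the action, so these differences descend to the orbit space.
  set G : (Euc n × Euc n) → PhaseSpace n → ℂ :=
    fun c x => F (x.1 + toTorus c.1, x.2 + c.2) - F x with hG
  have hGinv : ∀ c x y, (orbitSetoid v w).r x y → G c x = G c y := by
    rintro c x y ⟨a, b, h, h1, h2⟩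
    have e1 : F x = F y := by
      rw [hf, hf]; exact congrArg f (orbitProj_eq_iff.2 ⟨a, b, h, h1, h2⟩)
    have e2 : F (x.1 + toTorus c.1, x.2 + c.2) = F (y.1 + toTorus c.1, y.2 + c.2) := by
      rw [hf, hf]
      refine congrArg f (orbitProj_eq_iff.2 ⟨a, b, h, ?_, ?_⟩)
      · rw [h1]; exact add_right_comm _ _ _
      · rw [h2]; exact add_right_comm _ _ _
    simp only [hG, e1, e2]
  set D : (Euc n × Euc n) × OrbitSpace v w → ℂ := fun z => Quotient.lift (G z.1) (hGinv z.1) z.2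
  have hD : Continuous D := by
    rw [← (IsOpenQuotientMap.id.prodMap hπ).continuous_comp_iff]
    change Continuous fun z : (Euc n × Euc n) × PhaseSpace n => G z.1 z.2
    have := continuous_toTorus (n := n)
    have := F.continuous
    simp only [hG]
    fun_prop
  obtain ⟨K, hK, hKf⟩ := Filter.mem_cocompact.1
    (Metric.tendsto_nhds.1 (ZeroAtInftyContinuousMap.zero_at_infty' f) (ε / 2) (half_pos hε))
  have hKf' : ∀ x, orbitProj v w x ∉ K → ‖F x‖ < ε / 2 := fun x hx => by
    rw [hf]; simpa using hKf hx
  -- The difference vanishes for zero translation; compactness of `K` gives one neighbourhood of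
  -- zero for all orbits in `K`.
  obtain ⟨U, W, hU, -, h0U, hKW, hUW⟩ := generalized_tube_lemma
    (isCompact_singleton (x := (0 : Euc n × Euc n))) hK
    (isOpen_lt hD.norm (continuous_const (y := ε))) (by
      rintro ⟨c, y⟩ ⟨hc, -⟩
      obtain ⟨x, rfl⟩ := hπ.surjective y
      obtain rfl : c = 0 := hc
      change ‖G 0 x‖ < ε
      simpa [hG] using hε)
  obtain ⟨δ, hδ, hδU⟩ := Metric.isOpen_iff.1 hU 0 (h0U rfl)
  have key : ∀ a b : Euc n, ‖a‖ < δ → ‖b‖ < δ → ∀ x, orbitProj v w x ∈ K → ‖G (a, b) x‖ < ε := by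
    intro a b ha hb x hx
    have : (a, b) ∈ U := hδU (by rw [mem_ball_zero_iff, Prod.norm_mk]; exact max_lt ha hb)
    exact hUW (Set.mk_mem_prod this (hKW hx))
  refine ⟨δ, hδ, fun a b ha hb x => ?_⟩
  by_cases hx : orbitProj v w x ∈ K
  · exact key a b ha hb x hx
  -- If only the translated point lies over `K`, translate back from it; if neither does, both
  -- values are small.
  by_cases hy : orbitProj v w (x.1 + toTorus a, x.2 + b) ∈ K
  · have := key (-a) (-b) (by rwa [norm_neg]) (by rwa [norm_neg]) _ hy
    simpa [hG, toTorus_neg, norm_sub_rev] using this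
  · refine (norm_sub_le _ _).trans_lt ?_
    linarith [hKf' x hx, hKf' _ hy]

/-! ### Shears -/

/-- The affine shear `(q, p) ↦ (q + [τ p], p + c)` of the phase space. -/
def shear (τ : ℝ) (c : Euc n) : PhaseSpace n ≃ₜ PhaseSpace n where
  toFun x := (x.1 + toTorus (τ • x.2), x.2 + c)
  invFun x := (x.1 - toTorus (τ • (x.2 - c)), x.2 - c)
  left_inv x := by simp
  right_inv x := by simp
  continuous_toFun := by
    have := continuous_toTorus (n := n)
    fun_prop
  continuous_invFun := by
    have := continuous_toTorus (n := n)
    fun_prop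

lemma shear_apply (τ : ℝ) (c : Euc n) (x : PhaseSpace n) :
    shear τ c x = (x.1 + toTorus (τ • x.2), x.2 + c) := rfl

/-- The shear turns translation by `(a, b)` into translation by `(a + τ b, b)`, and `v · (a + τ b) +
w · b = v · a + (w + τ v) · b`. -/
lemma orbitProj_shear_eq_iff (v w : Euc n) (τ : ℝ) (c : Euc n) (x y : PhaseSpace n) :
    orbitProj v w (shear τ c x) = orbitProj v w (shear τ c y) ↔
      orbitProj v (w + τ • v) x = orbitProj v (w + τ • v) y := by
  rw [orbitProj_eq_iff, orbitProj_eq_iff]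
  simp only [shear_apply, inner_add_left, real_inner_smul_left]
  constructor
  · rintro ⟨a, b, h, h1, h2⟩
    have h2' : y.2 = x.2 + b := by
      rw [add_right_comm] at h2
      exact add_right_cancel h2
    refine ⟨a - τ • b, b, ?_, ?_, h2'⟩
    · rw [inner_sub_right, real_inner_smul_right]; linarith
    · rw [h2', smul_add, toTorus_add] at h1
      rw [toTorus_sub, eq_sub_of_add_eq h1]
      abel
  · rintro ⟨a, b, h, h1, h2⟩
    refine ⟨a + τ • b, b, ?_, ?_, ?_⟩
    · rw [inner_add_right, real_inner_smul_right]; linarith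
    · rw [h1, h2, smul_add, toTorus_add, toTorus_add]; abel
    · rw [h2, add_right_comm]

lemma compContinuous_shear_mem {F : PhaseSpace n →ᵇ ℂ} (hF : F ∈ resolventGenerators n)
    (τ : ℝ) (c : Euc n) :
    F.compContinuous (shear τ c : C(PhaseSpace n, PhaseSpace n)) ∈ resolventGenerators n := by
  obtain ⟨v, w, f, hf⟩ := hF
  let e : OrbitSpace v (w + τ • v) ≃ₜ OrbitSpace v w :=
    Homeomorph.mk
      (Quotient.congr (shear τ c).toEquiv fun x y =>
        (Quotient.eq (r := orbitSetoid v (w + τ • v))).symm.trans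
          ((orbitProj_shear_eq_iff v w τ c x y).symm.trans (Quotient.eq (r := orbitSetoid v w))))
      ((isOpenQuotientMap_orbitProj v (w + τ • v)).continuous_comp_iff.1
        ((isOpenQuotientMap_orbitProj v w).continuous.comp (shear τ c).continuous))
      ((isOpenQuotientMap_orbitProj v w).continuous_comp_iff.1
        ((isOpenQuotientMap_orbitProj v (w + τ • v)).continuous.comp (shear τ c).symm.continuous))
  refine ⟨v, w + τ • v, f.comp ⟨⟨e, e.continuous⟩, e.isClosedEmbedding.tendsto_cocompact⟩,
    fun x => ?_⟩
  exact hf _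

/-! ### Characters of the torus and functions of one momentum component -/

/-- The integer vector `k` as an element of `ℝⁿ`. -/
def intVec (k : Fin n → ℤ) : Euc n := WithLp.toLp 2 fun i => (k i : ℝ)

lemma intVec_ne_zero {k : Fin n → ℤ} (hk : k ≠ 0) : intVec k ≠ 0 := by
  intro h
  refine hk (funext fun i => ?_)
  have : (k i : ℝ) = 0 := congrFun (congrArg WithLp.ofLp h) i
  exact_mod_cast this

lemma mFourier_add_toTorus (k : Fin n → ℤ) (q : Torus n) (a : Euc n) :
    UnitAddTorus.mFourier k (q + toTorus a) =
      UnitAddTorus.mFourier k q * Complex.exp (2 * Real.pi * Complex.I * (inner ℝ (intVec k) a : ℝ)) := by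
  have h : (2 * Real.pi * Complex.I * (inner ℝ (intVec k) a : ℝ) : ℂ) =
      ∑ i, 2 * Real.pi * Complex.I * (k i) * (a i) := by
    simp only [PiLp.inner_apply, intVec]
    push_cast
    rw [Finset.mul_sum]
    refine Finset.sum_congr rfl fun i _ => ?_
    simp
    ring
  rw [h, Complex.exp_sum]
  simp only [UnitAddTorus.mFourier, ContinuousMap.coe_mk, ← Finset.prod_mul_distrib]
  refine Finset.prod_congr rfl fun i _ => ?_
  rw [Pi.add_apply, fourier_apply, smul_add, AddCircle.toCircle_add, Circle.coe_mul,
    ← fourier_apply, ← fourier_apply, toTorus_apply, fourier_coe_apply]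
  simp

/-- The function `(q, p) ↦ c q` on the phase space. -/
def ofTorus (c : C(Torus n, ℂ)) : PhaseSpace n →ᵇ ℂ :=
  (BoundedContinuousFunction.mkOfCompact c).compContinuous ⟨Prod.fst, continuous_fst⟩

lemma ofTorus_apply (c : C(Torus n, ℂ)) (x : PhaseSpace n) : ofTorus c x = c x.1 := rfl

lemma ofTorus_mFourier_mem (k : Fin n → ℤ) :
    ofTorus (UnitAddTorus.mFourier k) ∈ resolventGenerators n := by
  refine mem_resolventGenerators_of_isCompact (v := intVec k) (w := 0) (fun x y h => ?_)
    -- With `w = 0` every orbit meets the compact zero section, so decay is automatic.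
    fun ε _ => ⟨Set.univ ×ˢ {0}, isCompact_univ.prod isCompact_singleton, fun x _ => ?_⟩
  · obtain ⟨a, b, h, h1, -⟩ := orbitProj_eq_iff.1 h
    rw [inner_zero_left, add_zero] at h
    rw [ofTorus_apply, ofTorus_apply, h1, mFourier_add_toTorus, h]
    simp
  · exact ⟨(x.1, 0), ⟨trivial, rfl⟩, orbitProj_eq_iff.2 ⟨0, x.2, by simp, by simp, by simp⟩⟩

lemma mem_resolventGenerators_of_momentum {w : Euc n} (hw : w ≠ 0) {φ : ℝ → ℂ}
    (hφ : Filter.Tendsto φ (Filter.cocompact ℝ) (𝓝 0)) {F : PhaseSpace n →ᵇ ℂ}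
    (hF : ∀ x, F x = φ (inner ℝ w x.2)) : F ∈ resolventGenerators n := by
  refine mem_resolventGenerators_of_isCompact (v := 0) (w := w) (fun x y h => ?_) fun ε hε => ?_
  · obtain ⟨a, b, h, -, h2⟩ := orbitProj_eq_iff.1 h
    rw [inner_zero_left, zero_add] at h
    rw [hF, hF, h2, inner_add_right, h, add_zero]
  · obtain ⟨K, hK, hKφ⟩ := Filter.mem_cocompact.1 (Metric.tendsto_nhds.1 hφ ε hε)
    -- The point `(s / ‖w‖²) w` represents the hyperplane `w · p = s`.
    refine ⟨Set.univ ×ˢ ((fun s : ℝ => (s / ‖w‖ ^ 2) • w) '' K),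
      isCompact_univ.prod (hK.image (by fun_prop)), fun x hx => ?_⟩
    have hxK : inner ℝ w x.2 ∈ K := by
      by_contra h
      have := hKφ h
      rw [hF] at hx
      simp only [Set.mem_ofPred_eq, dist_zero_right] at this
      exact absurd hx this.not_ge
    refine ⟨(x.1, (inner ℝ w x.2 / ‖w‖ ^ 2) • w), ⟨trivial, _, hxK, rfl⟩,
      orbitProj_eq_iff.2 ⟨0, x.2 - (inner ℝ w x.2 / ‖w‖ ^ 2) • w, ?_, by simp, by simp⟩⟩
    rw [inner_zero_left, inner_sub_right, real_inner_smul_right, real_inner_self_eq_norm_sq,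
      div_mul_cancel₀ _ (pow_ne_zero 2 (norm_ne_zero_iff.2 hw)), sub_self, zero_add]

/-! ### The resolvent algebra -/

lemma subset_resolventAlgebra : resolventGenerators n ⊆ resolventAlgebra n := fun _ hF =>
  NonUnitalStarSubalgebra.le_topologicalClosure _ (NonUnitalStarAlgebra.subset_adjoin ℂ _ hF)

lemma isClosed_resolventAlgebra : IsClosed (resolventAlgebra n : Set (PhaseSpace n →ᵇ ℂ)) :=
  NonUnitalStarSubalgebra.isClosed_topologicalClosure _

lemma one_mem_resolventAlgebra : (1 : PhaseSpace n →ᵇ ℂ) ∈ resolventAlgebra n := by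
  have := subset_resolventAlgebra (ofTorus_mFourier_mem (0 : Fin n → ℤ))
  rw [UnitAddTorus.mFourier_zero] at this
  exact this

/-- Pull-back along a continuous map, as a star homomorphism. -/
def pullback (g : C(PhaseSpace n, PhaseSpace n)) :
    (PhaseSpace n →ᵇ ℂ) →⋆ₙₐ[ℂ] (PhaseSpace n →ᵇ ℂ) where
  toFun f := f.compContinuous g
  map_smul' _ _ := rfl
  map_zero' := rfl
  map_add' _ _ := rfl
  map_mul' _ _ := rfl
  map_star' _ := rfl

lemma compContinuous_mem_resolventAlgebra {g : C(PhaseSpace n, PhaseSpace n)}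
    (hg : ∀ F ∈ resolventGenerators n, F.compContinuous g ∈ resolventAlgebra n)
    {f : PhaseSpace n →ᵇ ℂ} (hf : f ∈ resolventAlgebra n) :
    f.compContinuous g ∈ resolventAlgebra n := by
  have h : resolventAlgebra n ≤ (resolventAlgebra n).comap (pullback g) :=
    NonUnitalStarSubalgebra.topologicalClosure_minimal _
      (NonUnitalStarAlgebra.adjoin_le hg)
      (isClosed_resolventAlgebra.preimage (BoundedContinuousFunction.continuous_compContinuous g))
  exact h hf

/-! ### Time averages along free trajectories -/

/-- The function `(q, p) ↦ ∫₀^τ c (q + [s p]) ds`. -/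
def freeAverage (τ : ℝ) (c : C(Torus n, ℂ)) : PhaseSpace n →ᵇ ℂ :=
  BoundedContinuousFunction.ofNormedAddCommGroup
    (fun x => ∫ s in (0 : ℝ)..τ, c (x.1 + toTorus (s • x.2)))
    (by
      have := continuous_toTorus (n := n)
      exact intervalIntegral.continuous_parametric_intervalIntegral_of_continuous'
        (by fun_prop) 0 τ)
    (‖c‖ * |τ|) fun x => by
      have := intervalIntegral.norm_integral_le_of_norm_le_const (a := 0) (b := τ)
        (f := fun s => c (x.1 + toTorus (s • x.2))) fun s _ => c.norm_coe_le_norm _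
      rwa [sub_zero] at this

lemma freeAverage_apply (τ : ℝ) (c : C(Torus n, ℂ)) (x : PhaseSpace n) :
    freeAverage τ c x = ∫ s in (0 : ℝ)..τ, c (x.1 + toTorus (s • x.2)) := rfl

lemma norm_freeAverage_le (τ : ℝ) (c : C(Torus n, ℂ)) : ‖freeAverage τ c‖ ≤ |τ| * ‖c‖ := by
  rw [mul_comm]
  exact BoundedContinuousFunction.norm_ofNormedAddCommGroup_le _ (by positivity) _

/-- `freeAverage` as a continuous linear map. -/
def freeAverageCLM (τ : ℝ) : C(Torus n, ℂ) →L[ℂ] (PhaseSpace n →ᵇ ℂ) :=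
  LinearMap.mkContinuous
    { toFun := freeAverage τ
      map_add' := fun c d => by
        ext x
        have := continuous_toTorus (n := n)
        simp only [BoundedContinuousFunction.coe_add, Pi.add_apply, freeAverage_apply,
          ContinuousMap.add_apply]
        exact intervalIntegral.integral_add (Continuous.intervalIntegrable (by fun_prop) _ _)
          (Continuous.intervalIntegrable (by fun_prop) _ _)
      map_smul' := fun r c => by
        ext x
        simp only [BoundedContinuousFunction.coe_smul, freeAverage_apply,
          ContinuousMap.smul_apply, RingHom.id_apply]
        exact intervalIntegral.integral_smul _ _ }
    |τ| (norm_freeAverage_le τ)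

/-- The integral is `(exp(2πi y τ) - 1) / (2πi y)`, of modulus at most `1 / |y|`. -/
lemma tendsto_integral_exp_cocompact (τ : ℝ) :
    Filter.Tendsto (fun y : ℝ => ∫ s in (0 : ℝ)..τ, Complex.exp (2 * Real.pi * Complex.I * y * s))
      (Filter.cocompact ℝ) (𝓝 0) := by
  have hb : ∀ y : ℝ, y ≠ 0 →
      ‖∫ s in (0 : ℝ)..τ, Complex.exp (2 * Real.pi * Complex.I * y * s)‖ ≤ ‖y‖⁻¹ := fun y hy => by
    have hy' : (2 * Real.pi * Complex.I * y : ℂ) ≠ 0 := by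
      have := Complex.I_ne_zero
      have := Real.pi_ne_zero
      simp_all
    have h1 : ∀ s : ℝ, ‖Complex.exp (2 * Real.pi * Complex.I * y * s)‖ = 1 := fun s => by
      rw [show (2 * Real.pi * Complex.I * y * s : ℂ) = ((2 * Real.pi * y * s : ℝ) : ℂ) * Complex.I by
        push_cast; ring, Complex.norm_exp_ofReal_mul_I]
    rw [integral_exp_mul_complex hy', norm_div]
    have h2 : ‖(2 * Real.pi * Complex.I * y : ℂ)‖ = 2 * Real.pi * ‖y‖ := by
      simp [abs_of_pos Real.pi_pos]
    rw [h2, div_le_iff₀ (by positivity)]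
    have h3 : ‖y‖⁻¹ * (2 * Real.pi * ‖y‖) = 2 * Real.pi := by
      field_simp [norm_ne_zero_iff.2 hy]
    rw [h3]
    refine (norm_sub_le _ _).trans ?_
    rw [h1, h1]
    linarith [Real.pi_gt_three]
  refine squeeze_zero_norm' ?_ (tendsto_inv_atTop_zero.comp tendsto_norm_cocompact_atTop)
  filter_upwards [(isCompact_singleton (x := (0 : ℝ))).compl_mem_cocompact] with y hy
  exact hb y hy

/-- Free motion for time `s` multiplies the character by the phase `exp(2πi s k · p)`, so the
average factors into the character and a function of `k · p`. -/
lemma freeAverage_mFourier_mem (τ : ℝ) (k : Fin n → ℤ) :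
    freeAverage τ (UnitAddTorus.mFourier k) ∈ resolventAlgebra n := by
  set φ : ℝ → ℂ := fun y => ∫ s in (0 : ℝ)..τ, Complex.exp (2 * Real.pi * Complex.I * y * s) with hφ
  have hφc : Continuous φ :=
    intervalIntegral.continuous_parametric_intervalIntegral_of_continuous'
      (f := fun y s : ℝ => Complex.exp (2 * Real.pi * Complex.I * y * s)) (by fun_prop) 0 τ
  have hφb : ∀ y, ‖φ y‖ ≤ 1 * |τ| := fun y => by
    have := intervalIntegral.norm_integral_le_of_norm_le_const (a := 0) (b := τ) (C := 1)
      (f := fun s : ℝ => Complex.exp (2 * Real.pi * Complex.I * y * s)) fun s _ => by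
        rw [show (2 * Real.pi * Complex.I * y * s : ℂ) =
          ((2 * Real.pi * y * s : ℝ) : ℂ) * Complex.I by
            push_cast; ring, Complex.norm_exp_ofReal_mul_I]
    rwa [sub_zero] at this
  set P : PhaseSpace n →ᵇ ℂ := BoundedContinuousFunction.ofNormedAddCommGroup
    (fun x => φ (inner ℝ (intVec k) x.2)) (hφc.comp (by fun_prop)) (1 * |τ|) fun x => hφb _ with hP
  have hPmem : P ∈ resolventAlgebra n := by
    by_cases hk : k = 0
    · have : P = (τ : ℂ) • (1 : PhaseSpace n →ᵇ ℂ) := by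
        ext x
        have h0 : inner ℝ (intVec k) x.2 = 0 := by
          rw [hk, show intVec (0 : Fin n → ℤ) = 0 by ext i; simp [intVec], inner_zero_left]
        change φ (inner ℝ (intVec k) x.2) = _
        rw [h0]
        simp [hφ]
      rw [this]
      exact SMulMemClass.smul_mem _ one_mem_resolventAlgebra
    · exact subset_resolventAlgebra (mem_resolventGenerators_of_momentum (intVec_ne_zero hk)
        (tendsto_integral_exp_cocompact τ) fun x => rfl)
  have : freeAverage τ (UnitAddTorus.mFourier k) = ofTorus (UnitAddTorus.mFourier k) * P := by
    ext x
    change ∫ s in (0 : ℝ)..τ, UnitAddTorus.mFourier k (x.1 + toTorus (s • x.2)) =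
      UnitAddTorus.mFourier k x.1 * φ (inner ℝ (intVec k) x.2)
    rw [hφ, ← intervalIntegral.integral_const_mul]
    refine intervalIntegral.integral_congr fun s _ => ?_
    simp only [mFourier_add_toTorus, real_inner_smul_right]
    push_cast
    ring_nf
  rw [this]
  exact mul_mem (subset_resolventAlgebra (ofTorus_mFourier_mem k)) hPmem

lemma freeAverage_mem (τ : ℝ) (c : C(Torus n, ℂ)) : freeAverage τ c ∈ resolventAlgebra n := by
  set S := (resolventAlgebra n).toNonUnitalSubalgebra.toSubmodule.comap
    (freeAverageCLM (n := n) τ : C(Torus n, ℂ) →ₗ[ℂ] (PhaseSpace n →ᵇ ℂ)) with hS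
  have h1 : Submodule.span ℂ (Set.range (UnitAddTorus.mFourier (d := Fin n))) ≤ S := by
    refine Submodule.span_le.2 ?_
    rintro _ ⟨k, rfl⟩
    exact freeAverage_mFourier_mem τ k
  have h2 : IsClosed (S : Set C(Torus n, ℂ)) :=
    isClosed_resolventAlgebra.preimage (freeAverageCLM (n := n) τ).continuous
  have h3 := Submodule.topologicalClosure_minimal _ h1 h2
  rw [UnitAddTorus.span_mFourier_closure_eq_top] at h3
  exact h3 (Submodule.mem_top (x := c))

/-! ### Substituting an element of the algebra for a parameter -/

lemma pow_mem_resolventAlgebra {f : PhaseSpace n →ᵇ ℂ} (hf : f ∈ resolventAlgebra n) (k : ℕ) :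
    f ^ k ∈ resolventAlgebra n := by
  induction k with
  | zero => rw [pow_zero]; exact one_mem_resolventAlgebra
  | succ k ih => rw [pow_succ]; exact mul_mem ih hf

/-- The Bernstein approximants of `T`, with `U` in place of the variable, are sums of products in
the algebra. They converge uniformly over the parameter, hence uniformly in `x` after substitution.
-/
lemma mem_resolventAlgebra_of_unitInterval (T : C(unitInterval, PhaseSpace n →ᵇ ℂ))
    (hT : ∀ r, T r ∈ resolventAlgebra n) {U H : PhaseSpace n →ᵇ ℂ} (hU : U ∈ resolventAlgebra n)
    (u : PhaseSpace n → unitInterval) (hUu : ∀ x, U x = ((u x : ℝ) : ℂ))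
    (hH : ∀ x, H x = T (u x) x) : H ∈ resolventAlgebra n := by
  set B : ℕ → PhaseSpace n →ᵇ ℂ := fun m => ∑ k : Fin (m + 1),
    ((m.choose k : ℂ) • (U ^ (k : ℕ) * (1 - U) ^ (m - k : ℕ))) * T (bernstein.z k) with hB
  have hBmem : ∀ m, B m ∈ resolventAlgebra n := fun m => by
    refine sum_mem fun k _ => mul_mem (SMulMemClass.smul_mem _ (mul_mem ?_ ?_)) (hT _)
    · exact pow_mem_resolventAlgebra hU _
    · exact pow_mem_resolventAlgebra (sub_mem one_mem_resolventAlgebra hU) _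
  have hBx : ∀ m x, B m x = bernsteinApproximation m T (u x) x := fun m x => by
    rw [bernsteinApproximation.apply, hB]
    simp only [BoundedContinuousFunction.coe_sum, Finset.sum_apply]
    refine Finset.sum_congr rfl fun k _ => ?_
    simp [bernstein_apply, hUu]
    ring
  refine isClosed_resolventAlgebra.mem_of_tendsto (f := B) (b := Filter.atTop) ?_
    (Filter.Eventually.of_forall hBmem)
  rw [tendsto_iff_dist_tendsto_zero]
  refine squeeze_zero (fun _ => dist_nonneg) (fun m => ?_)
    (tendsto_iff_dist_tendsto_zero.1 (bernsteinApproximation_uniform T))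
  refine (BoundedContinuousFunction.dist_le dist_nonneg).2 fun x => ?_
  rw [hBx, hH]
  exact (BoundedContinuousFunction.dist_coe_le_dist x).trans (ContinuousMap.dist_apply_le_dist _)

/-- If `T` is a norm continuous family in the resolvent algebra and `s` is a real element of it,
then `x ↦ T (s x) x` belongs to the resolvent algebra. -/
lemma mem_resolventAlgebra_of_real {T : ℝ → PhaseSpace n →ᵇ ℂ} (hTc : Continuous T)
    (hT : ∀ r, T r ∈ resolventAlgebra n) {S H : PhaseSpace n →ᵇ ℂ} (hS : S ∈ resolventAlgebra n)
    (s : PhaseSpace n → ℝ) (hSs : ∀ x, S x = (s x : ℂ)) (hH : ∀ x, H x = T (s x) x) :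
    H ∈ resolventAlgebra n := by
  -- The added `1` makes `M` positive, so `s` can be rescaled affinely from `[-M, M]` to the unit
  -- interval.
  set M : ℝ := ‖S‖ + 1 with hM
  have hM0 : 0 < M := by positivity
  have hs : ∀ x, |s x| ≤ M := fun x => by
    have := S.norm_coe_le_norm x
    rw [hSs, Complex.norm_real, Real.norm_eq_abs] at this
    linarith
  have hu : ∀ x, (s x + M) / (2 * M) ∈ unitInterval := fun x => by
    have := abs_le.1 (hs x)
    exact ⟨div_nonneg (by linarith) (by positivity), (div_le_one (by positivity)).2 (by linarith)⟩
  refine mem_resolventAlgebra_of_unitInterval ⟨fun r => T (2 * M * r - M), by fun_prop⟩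
    (fun r => hT _) (U := ((2 * M : ℝ) : ℂ)⁻¹ • (S + (M : ℂ) • 1)) ?_ (fun x => ⟨_, hu x⟩)
    (fun x => ?_) (fun x => ?_)
  · exact SMulMemClass.smul_mem _ (add_mem hS (SMulMemClass.smul_mem _ one_mem_resolventAlgebra))
  · simp [hSs]
    ring
  · rw [hH]
    simp only [ContinuousMap.coe_mk]
    rw [mul_div_cancel₀ _ (by positivity : (2 * M) ≠ 0), add_sub_cancel_right]

/-! ### A one-step approximation of Newton's equation -/

section NewtonStep

variable {E : Type*} [NormedAddCommGroup E] [NormedSpace ℝ E]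

/-- The step of length `τ` that lets the force act along the free trajectory. -/
def newtonStep (f : E → E) (τ : ℝ) (z : E × E) : E × E :=
  (z.1 + τ • z.2, z.2 + ∫ s in (0 : ℝ)..τ, f (z.1 + s • z.2))

variable [CompleteSpace E] {f : E → E} {K M : NNReal} {z : ℝ → E × E}

lemma newton_snd_eq (hf : Continuous f) (hz : ∀ t, HasDerivAt z ((z t).2, f (z t).1) t)
    (t τ : ℝ) : (z (t + τ)).2 = (z t).2 + ∫ s in (0 : ℝ)..τ, f (z (t + s)).1 := by
  have hzc : Continuous z := continuous_iff_continuousAt.2 fun t => (hz t).continuousAt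
  have hd : ∀ s, HasDerivAt (fun s => (z (t + s)).2) (f (z (t + s)).1) s := fun s =>
    ((hz (t + s)).comp_const_add t s).snd
  rw [intervalIntegral.integral_eq_sub_of_hasDerivAt (fun s _ => hd s)
    (Continuous.intervalIntegrable (by fun_prop) _ _), add_zero]
  abel

lemma newton_fst_eq (hz : ∀ t, HasDerivAt z ((z t).2, f (z t).1) t) (t τ : ℝ) :
    (z (t + τ)).1 = (z t).1 + ∫ s in (0 : ℝ)..τ, (z (t + s)).2 := by
  have hzc : Continuous z := continuous_iff_continuousAt.2 fun t => (hz t).continuousAt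
  have hd : ∀ s, HasDerivAt (fun s => (z (t + s)).1) (z (t + s)).2 s := fun s =>
    ((hz (t + s)).comp_const_add t s).fst
  rw [intervalIntegral.integral_eq_sub_of_hasDerivAt (fun s _ => hd s)
    (Continuous.intervalIntegrable (by fun_prop) _ _), add_zero]
  abel

lemma norm_newton_snd_sub_le (hf : Continuous f) (hM : ∀ x, ‖f x‖ ≤ M)
    (hz : ∀ t, HasDerivAt z ((z t).2, f (z t).1) t) (t s : ℝ) :
    ‖(z (t + s)).2 - (z t).2‖ ≤ M * |s| := by
  rw [newton_snd_eq hf hz, add_sub_cancel_left]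
  have := intervalIntegral.norm_integral_le_of_norm_le_const (a := 0) (b := s)
    (f := fun s => f (z (t + s)).1) fun s _ => hM _
  rwa [sub_zero] at this

lemma abs_le_of_mem_uIoc_zero {r s : ℝ} (h : r ∈ Set.uIoc 0 s) : |r| ≤ |s| := by
  have := Set.abs_sub_left_of_mem_uIcc (Set.uIoc_subset_uIcc h)
  simpa using this

lemma norm_newton_fst_sub_le (hf : Continuous f) (hM : ∀ x, ‖f x‖ ≤ M)
    (hz : ∀ t, HasDerivAt z ((z t).2, f (z t).1) t) (t s : ℝ) :
    ‖(z (t + s)).1 - ((z t).1 + s • (z t).2)‖ ≤ M * |s| * |s| := by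
  have hzc : Continuous z := continuous_iff_continuousAt.2 fun t => (hz t).continuousAt
  have h1 : (z (t + s)).1 - ((z t).1 + s • (z t).2) =
      ∫ r in (0 : ℝ)..s, ((z (t + r)).2 - (z t).2) := by
    rw [intervalIntegral.integral_sub (Continuous.intervalIntegrable (by fun_prop) _ _)
      (Continuous.intervalIntegrable (by fun_prop) _ _), newton_fst_eq hz]
    simp
  rw [h1]
  have := intervalIntegral.norm_integral_le_of_norm_le_const (a := 0) (b := s) (C := M * |s|)
    (f := fun r => (z (t + r)).2 - (z t).2) fun r hr =>
      (norm_newton_snd_sub_le hf hM hz t r).trans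
        (mul_le_mul_of_nonneg_left (abs_le_of_mem_uIoc_zero hr) M.2)
  rwa [sub_zero] at this

lemma norm_newton_fst_sub_add_smul_le (hf : Continuous f) (hM : ∀ x, ‖f x‖ ≤ M)
    (hz : ∀ t, HasDerivAt z ((z t).2, f (z t).1) t) (t s : ℝ) (y : E × E) :
    ‖(z (t + s)).1 - (y.1 + s • y.2)‖ ≤ (1 + |s|) * ‖z t - y‖ + M * |s| * |s| := by
  have h1 : (z (t + s)).1 - (y.1 + s • y.2) = (z t - y).1 + s • (z t - y).2 +
      ((z (t + s)).1 - ((z t).1 + s • (z t).2)) := by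
    rw [Prod.fst_sub, Prod.snd_sub, smul_sub]
    abel
  have h2 := norm_fst_le (z t - y)
  have h3 : ‖s • (z t - y).2‖ ≤ |s| * ‖z t - y‖ := by
    rw [norm_smul, Real.norm_eq_abs]
    exact mul_le_mul_of_nonneg_left (norm_snd_le _) (abs_nonneg s)
  rw [h1]
  refine (norm_add₃_le).trans ?_
  linarith [norm_newton_fst_sub_le hf hM hz t s]

/-- Over time `s` the true position leaves the free one by at most `M s²`, whatever the momentum,
and the Lipschitz force transmits this. The local error is thus of order `τ²` uniformly in `z t`. -/
lemma norm_newton_sub_newtonStep_le (hf : LipschitzWith K f) (hM : ∀ x, ‖f x‖ ≤ M)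
    (hz : ∀ t, HasDerivAt z ((z t).2, f (z t).1) t) {t τ R : ℝ} (hτ : |τ| ≤ R) (y : E × E) :
    ‖z (t + τ) - newtonStep f τ y‖ ≤
      (1 + |τ| * (1 + K * (1 + R))) * ‖z t - y‖ + M * (1 + K * R) * |τ| ^ 2 := by
  have hzc : Continuous z := continuous_iff_continuousAt.2 fun t => (hz t).continuousAt
  have hfc := hf.continuous
  have hR : 0 ≤ R := (abs_nonneg τ).trans hτ
  have hd := norm_nonneg (z t - y)
  have hτ0 := abs_nonneg τ
  refine norm_prod_le_iff.2 ⟨?_, ?_⟩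
  · refine (norm_newton_fst_sub_add_smul_le hfc hM hz t τ y).trans ?_
    have h1 : (0 : ℝ) ≤ |τ| * (K * (1 + R)) * ‖z t - y‖ := by positivity
    have h2 : (0 : ℝ) ≤ M * (K * R) * |τ| ^ 2 := by positivity
    linarith
  · have h1 : (z (t + τ) - newtonStep f τ y).2 = (z t - y).2 +
        ∫ s in (0 : ℝ)..τ, (f (z (t + s)).1 - f (y.1 + s • y.2)) := by
      rw [intervalIntegral.integral_sub (Continuous.intervalIntegrable (by fun_prop) _ _)
        (Continuous.intervalIntegrable (by fun_prop) _ _), Prod.snd_sub, newton_snd_eq hfc hz,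
        newtonStep, Prod.snd_sub]
      dsimp only
      abel
    have h2 := intervalIntegral.norm_integral_le_of_norm_le_const (a := 0) (b := τ)
      (C := K * ((1 + R) * ‖z t - y‖ + M * R * |τ|))
      (f := fun s => f (z (t + s)).1 - f (y.1 + s • y.2)) fun s hs => by
        have hs' := abs_le_of_mem_uIoc_zero hs
        have hs0 := abs_nonneg s
        rw [← dist_eq_norm]
        refine (hf.dist_le_mul _ _).trans ?_
        rw [dist_eq_norm]
        refine mul_le_mul_of_nonneg_left ?_ K.2
        refine (norm_newton_fst_sub_add_smul_le hfc hM hz t s y).trans ?_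
        gcongr
        · exact hs'.trans hτ
        · exact hs'.trans hτ
    rw [sub_zero] at h2
    rw [h1]
    refine (norm_add_le _ _).trans ?_
    have h3 := norm_snd_le (z t - y)
    have h4 : (0 : ℝ) ≤ |τ| * ‖z t - y‖ := by positivity
    have h5 : (0 : ℝ) ≤ M * |τ| ^ 2 := by positivity
    linarith

/-- Iterating `newtonStep` approximates the solutions of Newton's equation, uniformly in the
initial value. -/
theorem exists_norm_newton_sub_iterate_newtonStep_le (hf : LipschitzWith K f)
    (hM : ∀ x, ‖f x‖ ≤ M) (t : ℝ) :
    ∃ C : ℝ, ∀ z : ℝ → E × E, (∀ t, HasDerivAt z ((z t).2, f (z t).1) t) → ∀ N : ℕ, N ≠ 0 →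
      ‖z t - (newtonStep f (t / N))^[N] (z 0)‖ ≤ C / N := by
  refine ⟨M * (1 + K * |t|) * |t| ^ 2 * Real.exp (|t| * (1 + K * (1 + |t|))), fun z hz N hN => ?_⟩
  have hN0 : (N : ℝ) ≠ 0 := Nat.cast_ne_zero.2 hN
  set τ := t / N with hτdef
  have hτ : |τ| = |t| / N := by rw [hτdef, abs_div, Nat.abs_cast]
  have hτt : |τ| ≤ |t| := by
    rw [hτ]
    exact div_le_self (abs_nonneg t) (by exact_mod_cast Nat.one_le_iff_ne_zero.2 hN)
  -- The `N` local errors of order `(t / N)²` sum to order `1 / N`; the accumulated growth factors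
  -- are bounded by the exponential, independently of `N`.
  have h := discrete_gronwall (n₀ := 0)
    (u := fun j : ℕ => ‖z (j * τ) - (newtonStep f τ)^[j] (z 0)‖)
    (c := fun _ => |τ| * (1 + K * (1 + |t|))) (b := fun _ => M * (1 + K * |t|) * |τ| ^ 2)
    (norm_nonneg _) (fun j _ => by
      have := norm_newton_sub_newtonStep_le hf hM hz (t := j * τ) hτt ((newtonStep f τ)^[j] (z 0))
      rw [Function.iterate_succ_apply', Nat.cast_succ, add_one_mul]
      exact this)
    (fun _ _ => by positivity) (fun _ _ => by positivity) (Nat.zero_le N)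
  simp only [Nat.cast_zero, zero_mul, Function.iterate_zero, id_eq, sub_self, norm_zero, zero_add,
    Finset.sum_const, Nat.card_Ico, Nat.sub_zero, nsmul_eq_mul] at h
  rw [show (N : ℝ) * τ = t by rw [hτdef]; field_simp, hτ,
    ← mul_assoc (N : ℝ) (|t| / N), mul_div_cancel₀ _ hN0] at h
  refine h.trans (le_of_eq ?_)
  field_simp

end NewtonStep

/-! ### The one-step approximation on the phase space -/

/-- The image of `newtonStep` on the phase space. -/
def torusStep (F : C(Torus n, Euc n)) (τ : ℝ) : C(PhaseSpace n, PhaseSpace n) where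
  toFun x := (x.1 + toTorus (τ • x.2), x.2 + ∫ s in (0 : ℝ)..τ, F (x.1 + toTorus (s • x.2)))
  continuous_toFun := by
    have := continuous_toTorus (n := n)
    have h : Continuous fun x : PhaseSpace n => ∫ s in (0 : ℝ)..τ, F (x.1 + toTorus (s • x.2)) :=
      intervalIntegral.continuous_parametric_intervalIntegral_of_continuous' (by fun_prop) 0 τ
    fun_prop

lemma torusStep_apply (F : C(Torus n, Euc n)) (τ : ℝ) (x : PhaseSpace n) :
    torusStep F τ x =
      (x.1 + toTorus (τ • x.2), x.2 + ∫ s in (0 : ℝ)..τ, F (x.1 + toTorus (s • x.2))) := rfl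

lemma iterate_torusStep_toTorus (F : C(Torus n, Euc n)) (τ : ℝ) (N : ℕ) (z : Euc n × Euc n) :
    (torusStep F τ)^[N] (toTorus z.1, z.2) =
      (toTorus ((newtonStep (fun x => F (toTorus x)) τ)^[N] z).1,
        ((newtonStep (fun x => F (toTorus x)) τ)^[N] z).2) := by
  induction N with
  | zero => rfl
  | succ N ih =>
    rw [Function.iterate_succ_apply', Function.iterate_succ_apply', ih, torusStep_apply]
    simp only [newtonStep, toTorus_add]

/-- Changing `r` translates the image point by a multiple of `u`, so uniform continuity along
translations gives continuity in norm. -/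
lemma continuous_compContinuous_shear {G : PhaseSpace n →ᵇ ℂ} (hG : G ∈ resolventGenerators n)
    (τ : ℝ) (u : Euc n) : Continuous fun r : ℝ =>
      G.compContinuous (shear τ (r • u) : C(PhaseSpace n, PhaseSpace n)) := by
  refine Metric.continuous_iff.2 fun r ε hε => ?_
  obtain ⟨δ, hδ, h⟩ := resolventGenerators_uniformContinuous hG (half_pos hε)
  have hu : ContinuousAt (fun r' : ℝ => (r' - r) • u) r := by fun_prop
  obtain ⟨η, hη, hu⟩ := Metric.continuousAt_iff.1 hu δ hδ
  refine ⟨η, hη, fun r' hr' => ?_⟩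
  refine lt_of_le_of_lt ((BoundedContinuousFunction.dist_le (half_pos hε).le).2 fun x => ?_)
    (half_lt_self hε)
  have := h 0 ((r' - r) • u) (by simpa using hδ) (by simpa using hu hr') (shear τ (r • u) x)
  rw [dist_eq_norm]
  refine le_of_eq_of_le ?_ this.le
  simp [shear_apply, add_assoc, ← add_smul]

/-- The momentum increment is replaced by its component along `w`, which `G` cannot distinguish from
it. This leaves a one-parameter family of shears evaluated at a real element of the algebra. -/
lemma compContinuous_torusStep_mem {G : PhaseSpace n →ᵇ ℂ} (hG : G ∈ resolventGenerators n)
    (F : C(Torus n, Euc n)) (τ : ℝ) :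
    G.compContinuous (torusStep F τ) ∈ resolventAlgebra n := by
  obtain ⟨w, hw⟩ := resolventGenerators_apply_add hG
  have hcont := continuous_toTorus (n := n)
  refine mem_resolventAlgebra_of_real
    (T := fun r => G.compContinuous (shear τ (r • (‖w‖ ^ 2)⁻¹ • w) : C(PhaseSpace n, PhaseSpace n)))
    (continuous_compContinuous_shear hG τ _)
    (fun r => subset_resolventAlgebra (compContinuous_shear_mem hG τ _))
    (freeAverage_mem τ ⟨fun q => (inner ℝ w (F q) : ℝ), by fun_prop⟩)
    (fun x => inner ℝ w (∫ s in (0 : ℝ)..τ, F (x.1 + toTorus (s • x.2)))) (fun x => ?_)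
    fun x => ?_
  · rw [freeAverage_apply]
    simp only [ContinuousMap.coe_mk]
    rw [intervalIntegral.integral_ofReal]
    congr 1
    exact (innerSL ℝ w).intervalIntegral_comp_comm
      (Continuous.intervalIntegrable (by fun_prop) _ _)
  · change G (x.1 + toTorus (τ • x.2), x.2 + _) = G (x.1 + toTorus (τ • x.2), x.2 + _)
    refine hw _ _ _ _ ?_
    rw [real_inner_smul_right, real_inner_smul_right, real_inner_self_eq_norm_sq]
    -- For `w = 0` the inverse takes its default value `0`, and both inner products vanish.
    rcases eq_or_ne w 0 with rfl | h
    · simp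
    · rw [inv_mul_cancel₀ (pow_ne_zero 2 (norm_ne_zero_iff.2 h)), mul_one]

lemma compContinuous_iterate_torusStep_mem (F : C(Torus n, Euc n)) (τ : ℝ) (N : ℕ)
    {f : PhaseSpace n →ᵇ ℂ} (hf : f ∈ resolventAlgebra n) :
    f.compContinuous ⟨(torusStep F τ)^[N], (torusStep F τ).continuous.iterate N⟩ ∈
      resolventAlgebra n := by
  induction N with
  | zero => exact hf
  | succ N ih =>
    exact compContinuous_mem_resolventAlgebra
      (fun G hG => compContinuous_torusStep_mem hG F τ) ih

/-! ### The time evolution -/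

section Flow

variable {V : Torus n → ℝ} {K : NNReal} {Φ : ℝ → PhaseSpace n → PhaseSpace n}

/-- The force `-∇V`, as a continuous map. -/
def force (hK : LipschitzWith K (torusGradient V)) : C(Torus n, Euc n) :=
  ⟨fun q => -torusGradient V q, hK.continuous.neg⟩

/-- The error is written as a translation, the form required by
`resolventGenerators_uniformContinuous`; `C` does not depend on `x`. -/
lemma IsHamiltonianFlow.exists_eq_iterate_torusStep_add (hΦ : IsHamiltonianFlow V Φ)
    (hK : LipschitzWith K (torusGradient V)) (t : ℝ) :
    ∃ C : ℝ, ∀ N : ℕ, N ≠ 0 → ∀ x, ∃ a b : Euc n, ‖a‖ ≤ C / N ∧ ‖b‖ ≤ C / N ∧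
      Φ t x = (((torusStep (force hK) (t / N))^[N] x).1 + toTorus a,
        ((torusStep (force hK) (t / N))^[N] x).2 + b) := by
  obtain ⟨M, hM⟩ := exists_norm_torusGradient_le hK.continuous
  obtain ⟨C, hC⟩ := exists_norm_newton_sub_iterate_newtonStep_le (lipschitzWith_force hK) (M := M)
    (fun y => by rw [norm_neg]; exact hM _) t
  refine ⟨C, fun N hN x => ?_⟩
  obtain ⟨x₀, hx₀⟩ := toTorus_surjective x.1
  obtain ⟨z, hz0, hz, hzΦ⟩ := (hΦ x).1.exists_lift (x₀ := x₀) (by rw [(hΦ x).2, hx₀])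
  have hx : x = (toTorus (z 0).1, (z 0).2) := by
    rw [hz0, (hΦ x).2, hx₀]
  have h := hC z hz N hN
  set y := (newtonStep (fun x => -torusGradient V (toTorus x)) (t / N))^[N] (z 0) with hy
  have hit : (torusStep (force hK) (t / N))^[N] x = (toTorus y.1, y.2) := by
    conv_lhs => rw [hx]
    exact iterate_torusStep_toTorus (force hK) (t / N) N (z 0)
  refine ⟨(z t - y).1, (z t - y).2, (norm_fst_le _).trans h, (norm_snd_le _).trans h, ?_⟩
  rw [hit, hzΦ t, Prod.fst_sub, Prod.snd_sub, ← toTorus_add, add_sub_cancel, add_sub_cancel]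

lemma IsHamiltonianFlow.continuous (hΦ : IsHamiltonianFlow V Φ)
    (hK : LipschitzWith K (torusGradient V)) (t : ℝ) : Continuous (Φ t) := by
  obtain ⟨C, hC⟩ := hΦ.exists_eq_iterate_torusStep_add hK t
  have h : TendstoUniformly (fun (N : ℕ) x => (torusStep (force hK) (t / N))^[N] x) (Φ t)
      Filter.atTop := by
    refine Metric.tendstoUniformly_iff.2 fun ε hε => ?_
    filter_upwards [Filter.eventually_ne_atTop 0,
      (tendsto_const_div_atTop_nhds_zero_nat C).eventually_lt_const hε] with N hN hCN x
    obtain ⟨a, b, ha, hb, hab⟩ := hC N hN x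
    rw [hab, Prod.dist_eq]
    refine max_lt ?_ ?_
    · rw [dist_self_add_left]
      exact (norm_toTorus_le a).trans_lt (ha.trans_lt hCN)
    · rw [dist_self_add_left]
      exact hb.trans_lt hCN
  exact h.continuous (Filter.Eventually.frequently (Filter.Eventually.of_forall fun N =>
    (torusStep (force hK) (t / N)).continuous.iterate N))

/-- The time evolution, as a homeomorphism. -/
def IsHamiltonianFlow.homeomorph (hΦ : IsHamiltonianFlow V Φ)
    (hK : LipschitzWith K (torusGradient V)) (t : ℝ) : PhaseSpace n ≃ₜ PhaseSpace n where
  toFun := Φ t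
  invFun := Φ (-t)
  left_inv x := by rw [← hΦ.add hK, neg_add_cancel]; exact (hΦ x).2
  right_inv x := by rw [← hΦ.add hK, add_neg_cancel]; exact (hΦ x).2
  continuous_toFun := hΦ.continuous hK t
  continuous_invFun := hΦ.continuous hK (-t)

theorem IsHamiltonianFlow.compContinuous_mem (hΦ : IsHamiltonianFlow V Φ)
    (hK : LipschitzWith K (torusGradient V)) (t : ℝ) {f : PhaseSpace n →ᵇ ℂ}
    (hf : f ∈ resolventAlgebra n) :
    f.compContinuous ⟨Φ t, hΦ.continuous hK t⟩ ∈ resolventAlgebra n := by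
  refine compContinuous_mem_resolventAlgebra (fun G hG => ?_) hf
  obtain ⟨C, hC⟩ := hΦ.exists_eq_iterate_torusStep_add hK t
  refine isClosed_resolventAlgebra.mem_of_tendsto (b := Filter.atTop) ?_
    (Filter.Eventually.of_forall fun N : ℕ => compContinuous_iterate_torusStep_mem (force hK)
      (t / N) N (subset_resolventAlgebra hG))
  refine Metric.tendsto_nhds.2 fun ε hε => ?_
  obtain ⟨δ, hδ, h⟩ := resolventGenerators_uniformContinuous hG (half_pos hε)
  filter_upwards [Filter.eventually_ne_atTop 0,
    (tendsto_const_div_atTop_nhds_zero_nat C).eventually_lt_const hδ] with N hN hCN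
  refine lt_of_le_of_lt ((BoundedContinuousFunction.dist_le (half_pos hε).le).2 fun x => ?_)
    (half_lt_self hε)
  obtain ⟨a, b, ha, hb, hab⟩ := hC N hN x
  rw [dist_comm, dist_eq_norm, BoundedContinuousFunction.compContinuous_apply, ContinuousMap.coe_mk,
    hab]
  exact (h a b (ha.trans_lt hCN) (hb.trans_lt hCN) _).le

end Flow

end TorusResolvent

end

open TorusResolvent
theorem mainTheorem10 (n : ℕ) (V : Torus n → ℝ) (hV : IsC1 V)
    (hL : ∃ K : NNReal, LipschitzWith K (torusGradient V)) :
    (∀ x : PhaseSpace n, ∃! γ : ℝ → PhaseSpace n, IsHamiltonianTrajectory V γ ∧ γ 0 = x) ∧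
    ∀ Φ : ℝ → PhaseSpace n → PhaseSpace n, IsHamiltonianFlow V Φ → ∀ t : ℝ,
      ∃ e : PhaseSpace n ≃ₜ PhaseSpace n, (∀ x, e x = Φ t x) ∧
        (fun f : PhaseSpace n →ᵇ ℂ => f.compContinuous (e : C(PhaseSpace n, PhaseSpace n))) ''
          (resolventAlgebra n : Set (PhaseSpace n →ᵇ ℂ)) = resolventAlgebra n := by
  obtain ⟨K, hK⟩ := hL
  refine ⟨existsUnique_isHamiltonianTrajectory hK, fun Φ hΦ t =>
    ⟨hΦ.homeomorph hK t, fun x => rfl, Set.Subset.antisymm ?_ fun f hf => ?_⟩⟩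
  · rintro _ ⟨f, hf, rfl⟩
    exact hΦ.compContinuous_mem hK t hf
  -- The preimage of `f` is its pull-back along the inverse flow.
  · refine ⟨_, hΦ.compContinuous_mem hK (-t) hf, ?_⟩
    ext x
    exact congrArg f ((hΦ.homeomorph hK t).symm_apply_apply x)
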